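/- Let $\Gamma$ be a metric graph, given by a finite graph (loops and multiple edges allowed, no isolated vertices) with a positive finite length for each edge. For $p\in\Gamma$ let $T_p(\Gamma)$ be the set of outgoing tangent vectors at $p$. For $f\in \mathrm{PL}(\Gamma)$, the continuous piecewise linear functions with integer slopes, let $\mathrm{sl}_\eta(f)$ be the outgoing slope of $f$ along $\eta\in T_p(\Gamma)$, and put $\mathrm{div}(f)=\sum_p \mathrm{ord}_p(f)\cdot p$ with $\mathrm{ord}_p(f)=-\sum_{\eta\in T_p(\Gamma)}\mathrm{sl}_\eta(f)$. For a divisor $D$ let $R(D)=\{f\in\mathrm{PL}(\Gamma): \mathrm{div}(f)+D\ge 0\}$. A set of functions is tropically dependent if there are real constants $a_f$ such that at every point the minimum of the values $f+a_f$ is attained by at least two of the functions. A tropical submodule is a set of functions closed under tropical linear combinations $\min\{f_1+a_1,\dots,f_n+a_n\}$, $n\geq 1$, $a_i\in\mathbb R$. A tropical linear series of rank $r\ge 0$ is a pair $(D,\Sigma)$ with $\Sigma\subseteq R(D)$ a finitely generated tropical submodule such that (1) for every effective divisor $E$ of degree $r$ there is $f\in\Sigma$ with $\mathrm{div}(f)+D\ge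 E$, and (2) every set of $r+2$ functions in $\Sigma$ is tropically dependent. It is strongly recursive if, recursively, (3) for $r\ge1$, every set of $r$ functions in $\Sigma$ is contained in a strongly recursive tropical linear subseries $(D,\Sigma')$, $\Sigma'\subseteq\Sigma$, of rank $r-1$, and (4) if $S_1,S_2\subseteq\Sigma$ have sizes $s_1,s_2\le r$ with $s_1+s_2\ge r+2$, then there are strongly recursive tropical linear subseries $\Sigma_1\supseteq S_1$ and $\Sigma_2\supseteq S_2$ of ranks $s_1-1$ and $s_2-1$ such that $\Sigma_1\cap\Sigma_2$ contains a strongly recursive tropical linear series (with the same $D$) of rank $s_1+s_2-r-2$. Let $(D,\Sigma)$ be a strongly recursive tropical linear series of rank $r$ on $\Gamma$. Then for every tangent vector $\eta$ the set $\{\mathrm{sl}_\eta(f): f\in\Sigma\}$ has exactly $r+1$ elements $s_\eta[0]<\dots<s_\eta[r]$. For $p\in\Gamma$ and $f\in\Sigma$ let $\partial_p(f)\in\{0,\dots,r\}^{T_p(\Gamma)}$ be the vector with $\mathrm{sl}_\eta(f)=s_\eta[\partial_p(f)_\eta]$ for all $\eta\in T_p(\Gamma)$, and let $P_p=\{\partial_p(f):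 f\in\Sigma\}$ be the local array of $\Sigma$ at $p$. Then $P_p$ is totally rankable: for every $\mathbf x$, the number of distinct values of the $\eta$-coordinate on $\{\mathbf y\in P_p: \mathbf y\ge\mathbf x\}$ does not depend on $\eta\in T_p(\Gamma)$. Let $\rho_{P_p}(\mathbf x)$ be this number minus $1$, and define the local rank $\rho_p(f)=\rho_{P_p}(\partial_p(f))$. Moreover, for every effective divisor $E$ on $\Gamma$ with $\deg(E)=r$ there exists a single function $f\in\Sigma$ satisfying both $\mathrm{div}(f)+D\ge E$ and $\rho_p(f)\ge E(p)$ for all $p\in\Gamma$. -/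

import Mathlib

open scoped Topology

/-- A finite graph (loops and multiple edges allowed) with vertices `V` and edges `E`, together with
a positive finite length for every edge. Each edge is given an auxiliary orientation from `src` to
`tgt`, used only to parametrize it by the interval `[0, len e]`. -/
structure MetricGraph (V E : Type*) where
  src : E → V
  tgt : E → V
  len : E → ℝ
  len_pos : ∀ e, 0 < len e

namespace MetricGraph

variable {V E : Type*} (Γ : MetricGraph V E)

/-- The points of the metric graph: the vertices and the interior points of the edges. -/
inductive Point : Type _
  | vertex (v : V) : Point
  | interior (e : E) (t : Set.Ioo (0 : ℝ) (Γ.len e)) : Point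

open Classical in
/-- The parametrization of the edge `e` by `[0, len e]`. -/
noncomputable def edgePoint (e : E) (t : ℝ) : Γ.Point :=
  if h : t ∈ Set.Ioo (0 : ℝ) (Γ.len e) then .interior e ⟨t, h⟩
  else if t ≤ 0 then .vertex (Γ.src e) else .vertex (Γ.tgt e)

/-- An outgoing tangent vector at `p`: an edge `e`, a parameter `t` at which `e` passes through `p`,
and a direction (`fwd = true`: towards increasing parameters) in which `e` can be followed
from `t`. A loop at a vertex gives two tangent vectors there. -/
@[ext]
structure Tangent (p : Γ.Point) where
  e : E
  fwd : Bool
  t : ℝ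
  mem : t ∈ Set.Icc 0 (Γ.len e)
  room : if fwd then t < Γ.len e else 0 < t
  point_eq : Γ.edgePoint e t = p

variable {Γ}

/-- The point at distance `s` from `p` along the tangent vector `η` (for small `s ≥ 0`). -/
noncomputable def Tangent.ray {p : Γ.Point} (η : Γ.Tangent p) (s : ℝ) : Γ.Point :=
  Γ.edgePoint η.e (if η.fwd then η.t + s else η.t - s)

/-- A tangent vector is determined by its edge and its direction. -/
theorem Tangent.injective_edge_dir (p : Γ.Point) :
    Function.Injective (fun η : Γ.Tangent p => (η.e, η.fwd)) := by
  rintro ⟨e, b, t, ht, hr, hp⟩ ⟨e', b', t', ht', hr', hp'⟩ h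
  simp only [Prod.mk.injEq] at h
  obtain ⟨rfl, rfl⟩ := h
  have : t = t' := by
    have h := hp.trans hp'.symm
    unfold edgePoint at h
    have h1 := ht.1
    have h2 := ht.2
    have h3 := ht'.1
    have h4 := ht'.2
    split_ifs at h with i1 i2 i3 i4 i5 i6 i7 i8
    any_goals (injection h with _ h5; simpa using h5)
    all_goals
      clear h hp hp' ht ht'
      cases b <;> simp only [Set.mem_Ioo, Bool.false_eq_true, if_false, if_true] at * <;> grind
  subst this
  rfl

/-- Over a finite graph there are finitely many tangent vectors at every point. -/
instance [Finite E] (p : Γ.Point) : Finite (Γ.Tangent p) :=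
  Finite.of_injective _ (Tangent.injective_edge_dir p)

/-- `PL(Γ)`: the continuous piecewise linear functions with integer slopes. On every edge the
function is continuous, and affine with integer slope away from finitely many break points. -/
def IsPL (f : Γ.Point → ℝ) : Prop :=
  ∀ e, ContinuousOn (fun t => f (Γ.edgePoint e t)) (Set.Icc 0 (Γ.len e)) ∧
    ∃ B : Set ℝ, B.Finite ∧ ∀ a b, 0 ≤ a → a < b → b ≤ Γ.len e → Disjoint (Set.Ioo a b) B →
      ∃ (m : ℤ) (c : ℝ), ∀ t ∈ Set.Icc a b, f (Γ.edgePoint e t) = m * t + c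

/-- `f` has outgoing slope `m` along `η`. -/
def HasSlope {p : Γ.Point} (f : Γ.Point → ℝ) (η : Γ.Tangent p) (m : ℤ) : Prop :=
  ∀ᶠ s in 𝓝[>] (0 : ℝ), f (η.ray s) = f p + m * s

open Classical in
/-- The outgoing slope of `f` along `η`. -/
noncomputable def slope {p : Γ.Point} (f : Γ.Point → ℝ) (η : Γ.Tangent p) : ℤ :=
  if h : ∃ m, HasSlope f η m then h.choose else 0

theorem HasSlope.unique {p : Γ.Point} {f : Γ.Point → ℝ} {η : Γ.Tangent p} {m n : ℤ}
    (hm : HasSlope f η m) (hn : HasSlope f η n) : m = n := by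
  obtain ⟨s, ⟨h1, h2⟩, hs⟩ := ((hm.and hn).and self_mem_nhdsWithin).exists
  have hs' : s ≠ 0 := ne_of_gt hs
  have h3 : (m : ℝ) * s = n * s := by linarith
  exact_mod_cast mul_right_cancel₀ hs' h3

theorem HasSlope.slope_eq {p : Γ.Point} {f : Γ.Point → ℝ} {η : Γ.Tangent p} {m : ℤ}
    (hm : HasSlope f η m) : slope f η = m := by
  have h : ∃ m, HasSlope f η m := ⟨m, hm⟩
  rw [slope, dif_pos h]
  exact h.choose_spec.unique hm

/-- A finite set of reals misses a small interval to the right of any point. -/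
theorem exists_gap_right {B : Set ℝ} (hB : B.Finite) {t l : ℝ} (htl : t < l) :
    ∃ b, t < b ∧ b ≤ l ∧ Disjoint (Set.Ioo t b) B := by
  have h : ∀ᶠ x in 𝓝[>] t, x ∉ B := by
    have : (B \ {t})ᶜ ∈ 𝓝 t := (hB.subset Set.sdiff_subset).isClosed.isOpen_compl.mem_nhds (by simp)
    filter_upwards [nhdsWithin_le_nhds this, self_mem_nhdsWithin] with x hx hxt hxB
    exact hx ⟨hxB, ne_of_gt hxt⟩
  obtain ⟨u, hu, hsub⟩ := mem_nhdsGT_iff_exists_Ioo_subset.1 h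
  refine ⟨min u l, lt_min hu htl, min_le_right _ _, Set.disjoint_left.2 fun x hx => ?_⟩
  exact hsub ⟨hx.1, hx.2.trans_le (min_le_left _ _)⟩

theorem exists_gap_left {B : Set ℝ} (hB : B.Finite) {t l : ℝ} (htl : l < t) :
    ∃ a, l ≤ a ∧ a < t ∧ Disjoint (Set.Ioo a t) B := by
  have h : ∀ᶠ x in 𝓝[<] t, x ∉ B := by
    have : (B \ {t})ᶜ ∈ 𝓝 t := (hB.subset Set.sdiff_subset).isClosed.isOpen_compl.mem_nhds (by simp)
    filter_upwards [nhdsWithin_le_nhds this, self_mem_nhdsWithin] with x hx hxt hxB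
    exact hx ⟨hxB, ne_of_lt hxt⟩
  obtain ⟨u, hu, hsub⟩ := mem_nhdsLT_iff_exists_Ioo_subset.1 h
  refine ⟨max u l, le_max_right _ _, max_lt hu htl, Set.disjoint_left.2 fun x hx => ?_⟩
  exact hsub ⟨(le_max_left _ _).trans_lt hx.1, hx.2⟩

/-- A function in `PL(Γ)` has its slope along every tangent vector. -/
theorem IsPL.hasSlope {f : Γ.Point → ℝ} (hf : IsPL f) {p : Γ.Point} (η : Γ.Tangent p) :
    HasSlope f η (slope f η) := by
  suffices h : ∃ m, HasSlope f η m by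
    obtain ⟨m, hm⟩ := h
    rwa [hm.slope_eq]
  obtain ⟨e, b, t, ht, hr, rfl⟩ := η
  obtain ⟨-, B, hB, hlin⟩ := hf e
  cases b
  · simp only [Bool.false_eq_true, if_false] at hr
    obtain ⟨a, h0, hat, hd⟩ := exists_gap_left hB hr
    obtain ⟨m, c, h⟩ := hlin a t h0 hat ht.2 hd
    refine ⟨-m, ?_⟩
    have : Set.Ioo (0 : ℝ) (t - a) ∈ 𝓝[>] (0 : ℝ) := Ioo_mem_nhdsGT (by linarith)
    filter_upwards [this] with s hs
    have h1 := h t ⟨hat.le, le_rfl⟩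
    have h2 := h (t - s) ⟨by linarith [hs.2], by linarith [hs.1]⟩
    simp only [Tangent.ray, Bool.false_eq_true, if_false]
    rw [h1, h2]
    push_cast
    ring
  · simp only [if_true] at hr
    obtain ⟨b, htb, hbl, hd⟩ := exists_gap_right hB hr
    obtain ⟨m, c, h⟩ := hlin t b ht.1 htb hbl hd
    refine ⟨m, ?_⟩
    have : Set.Ioo (0 : ℝ) (b - t) ∈ 𝓝[>] (0 : ℝ) := Ioo_mem_nhdsGT (by linarith)
    filter_upwards [this] with s hs
    have h1 := h t ⟨le_rfl, htb.le⟩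
    have h2 := h (t + s) ⟨by linarith [hs.1], by linarith [hs.2]⟩
    simp only [Tangent.ray, if_true]
    rw [h1, h2]
    ring

/-- The order of vanishing of `f` at `p`, i.e. the coefficient of `div(f)` at `p`. -/
noncomputable def ord (f : Γ.Point → ℝ) (p : Γ.Point) : ℤ :=
  -∑ᶠ η : Γ.Tangent p, slope f η

variable (Γ) in
/-- Divisors: finitely supported integral formal sums of points. -/
abbrev Divisor := Γ.Point →₀ ℤ

/-- The degree of a divisor. -/
noncomputable def deg (D : Γ.Divisor) : ℤ := D.sum fun _ n => n

/-- `div(f) + D ≥ A`. For `A` effective this is the Baker-Norine rank property of `f` for `A`. -/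
def DivAddGE (D : Γ.Divisor) (f : Γ.Point → ℝ) (A : Γ.Divisor) : Prop :=
  ∀ p, A p ≤ ord f p + D p

/-- The complete linear series `R(D)`. -/
def completeSeries (D : Γ.Divisor) : Set (Γ.Point → ℝ) :=
  {f | IsPL f ∧ DivAddGE D f 0}

/-- The tropical submodule generated by `G`: all tropical linear combinations
`min {f₁ + a₁, …, fₙ + aₙ}` with `n ≥ 1`, `fᵢ ∈ G` and `aᵢ ∈ ℝ`. -/
def tropicalSpan (G : Set (Γ.Point → ℝ)) : Set (Γ.Point → ℝ) :=
  {f | ∃ (T : Finset (Γ.Point → ℝ)) (hT : T.Nonempty) (a : (Γ.Point → ℝ) → ℝ),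
    (T : Set (Γ.Point → ℝ)) ⊆ G ∧ ∀ p, f p = T.inf' hT fun g => g p + a g}

/-- `M` is a finitely generated tropical submodule. -/
def IsFGTropical (M : Set (Γ.Point → ℝ)) : Prop :=
  ∃ G : Set (Γ.Point → ℝ), G.Finite ∧ M = tropicalSpan G

/-- A finite set of functions is tropically dependent: for suitable constants, the minimum of the
functions `f + a f` is attained at least twice at every point. -/
def TropicallyDependent (T : Finset (Γ.Point → ℝ)) : Prop :=
  ∃ a : (Γ.Point → ℝ) → ℝ, ∀ p, ∃ f ∈ T, ∃ g ∈ T, f ≠ g ∧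
    f p + a f = g p + a g ∧ ∀ h ∈ T, f p + a f ≤ h p + a h

/-- `(D, M)` is a tropical linear series of rank `r`. -/
structure IsTLS (D : Γ.Divisor) (r : ℕ) (M : Set (Γ.Point → ℝ)) : Prop where
  subset : M ⊆ completeSeries D
  fg : IsFGTropical M
  rank : ∀ A : Γ.Divisor, 0 ≤ A → deg A = r → ∃ f ∈ M, DivAddGE D f A
  dependent : ∀ T : Finset (Γ.Point → ℝ), (T : Set (Γ.Point → ℝ)) ⊆ M → T.card = r + 2 →
    TropicallyDependent T

/-- `(D, M)` is a strongly recursive tropical linear series of rank `r`. The conditions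
`s₁, s₂ ≤ r` and `r + 2 ≤ s₁ + s₂` force `s₁, s₂ ≥ 2`, so no subtraction below is truncated. -/
def IsStronglyRecursive (D : Γ.Divisor) (r : ℕ) (M : Set (Γ.Point → ℝ)) : Prop :=
  IsTLS D r M ∧
  (∀ _ : 1 ≤ r, ∀ T : Finset (Γ.Point → ℝ), (T : Set (Γ.Point → ℝ)) ⊆ M → T.card = r →
    ∃ M' ⊆ M, (T : Set (Γ.Point → ℝ)) ⊆ M' ∧ IsStronglyRecursive D (r - 1) M') ∧
  (∀ s₁ s₂ : ℕ, ∀ _ : s₁ ≤ r, ∀ _ : s₂ ≤ r, ∀ _ : r + 2 ≤ s₁ + s₂,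
    ∀ T₁ T₂ : Finset (Γ.Point → ℝ),
    (T₁ : Set (Γ.Point → ℝ)) ⊆ M → (T₂ : Set (Γ.Point → ℝ)) ⊆ M → T₁.card = s₁ → T₂.card = s₂ →
    ∃ M₁ ⊆ M, ∃ M₂ ⊆ M, ∃ M₃ ⊆ M₁ ∩ M₂,
      (T₁ : Set (Γ.Point → ℝ)) ⊆ M₁ ∧ (T₂ : Set (Γ.Point → ℝ)) ⊆ M₂ ∧
      IsStronglyRecursive D (s₁ - 1) M₁ ∧ IsStronglyRecursive D (s₂ - 1) M₂ ∧
      IsStronglyRecursive D (s₁ + s₂ - r - 2) M₃)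
termination_by r
decreasing_by all_goals omega

/-! ### Dot arrays -/

/-- The principal subarray `P[x]`. -/
def principal {ι : Type*} (P : Set (ι → ℕ)) (x : ι → ℕ) : Set (ι → ℕ) :=
  {y ∈ P | x ≤ y}

/-- The rank of `P` along the `i`-axis. -/
noncomputable def axisRank {ι : Type*} (P : Set (ι → ℕ)) (i : ι) : ℤ :=
  (((fun x => x i) '' P).ncard : ℤ) - 1

/-- `P` is rankable of rank `s`. -/
def HasRank {ι : Type*} (P : Set (ι → ℕ)) (s : ℤ) : Prop :=
  ∀ i, axisRank P i = s

/-- `P` is totally rankable: every principal subarray is rankable. -/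
def TotallyRankable {ι : Type*} (P : Set (ι → ℕ)) : Prop :=
  ∀ x, ∃ s, HasRank (principal P x) s

open Classical in
/-- The rank array `ρ_P` of a totally rankable array `P` (of dimension at least `1`). -/
noncomputable def rankArray {ι : Type*} (P : Set (ι → ℕ)) (x : ι → ℕ) : ℤ :=
  if h : ∃ s, HasRank (principal P x) s then h.choose else -1

theorem rankArray_eq {ι : Type*} [Nonempty ι] {P : Set (ι → ℕ)} {x : ι → ℕ} {s : ℤ}
    (h : HasRank (principal P x) s) : rankArray P x = s := by
  have h' : ∃ s, HasRank (principal P x) s := ⟨s, h⟩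
  rw [rankArray, dif_pos h', ← h (Classical.arbitrary ι), h'.choose_spec (Classical.arbitrary ι)]

/-! ### Local arrays and local rank -/

/-- The set of slopes along `η` of the functions in `M`. -/
def slopeSet (M : Set (Γ.Point → ℝ)) {p : Γ.Point} (η : Γ.Tangent p) : Set ℤ :=
  (fun f => slope f η) '' M

/-- The position `∂_p(f)`: if the slopes of `M` along `η` are `s[0] < s[1] < ⋯ < s[r]`, then its
coordinate at `η` is the index `j` with `slope f η = s[j]`, i.e. the number of smaller slopes. -/
noncomputable def position (M : Set (Γ.Point → ℝ)) (p : Γ.Point) (f : Γ.Point → ℝ) :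
    Γ.Tangent p → ℕ :=
  fun η => {s ∈ slopeSet M η | s < slope f η}.ncard

/-- If `s` lists the slopes of `M` along `η` increasingly, then `position M p f η` is the index of
the slope of `f` in this list. -/
theorem position_eq_iff {M : Set (Γ.Point → ℝ)} {p : Γ.Point} {f : Γ.Point → ℝ} (hf : f ∈ M)
    {η : Γ.Tangent p} {r : ℕ} {s : Fin (r + 1) → ℤ} (hs : StrictMono s)
    (hrange : Set.range s = slopeSet M η) (j : Fin (r + 1)) :
    position M p f η = j ↔ slope f η = s j := by
  obtain ⟨k, hk⟩ : slope f η ∈ Set.range s := hrange ▸ ⟨f, hf, rfl⟩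
  have h : {t ∈ slopeSet M η | t < slope f η} = s '' (Finset.Iio k : Set (Fin (r + 1))) := by
    ext t
    rw [← hrange, ← hk]
    constructor
    · rintro ⟨⟨i, rfl⟩, hi⟩
      exact ⟨i, by simpa using hs.lt_iff_lt.1 hi, rfl⟩
    · rintro ⟨i, hi, rfl⟩
      exact ⟨⟨i, rfl⟩, hs (by simpa using hi)⟩
  have h2 : position M p f η = k := by
    rw [position, h, Set.ncard_image_of_injective _ hs.injective, Set.ncard_coe_finset, Fin.card_Iio]
  rw [h2, ← hk, hs.injective.eq_iff, Fin.val_inj]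

/-- The local array of `M` at `p`. -/
def localArray (M : Set (Γ.Point → ℝ)) (p : Γ.Point) : Set (Γ.Tangent p → ℕ) :=
  position M p '' M

/-- The local rank `ρ_p(f)` of `f ∈ M` at `p`. -/
noncomputable def localRank (M : Set (Γ.Point → ℝ)) (p : Γ.Point) (f : Γ.Point → ℝ) : ℤ :=
  rankArray (localArray M p) (position M p f)

/-- The local rank property of `f` for the divisor `A`. -/
def LocalRankProperty (M : Set (Γ.Point → ℝ)) (f : Γ.Point → ℝ) (A : Γ.Divisor) : Prop :=
  ∀ p, A p ≤ localRank M p f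

end MetricGraph

/-! Everything happens near a point `p`, along short rays on which the finitely many generators are
affine, so that a tropical combination is concave there and bends only where the minimising
generator changes.

Slope count: along `η`, functions with distinct slopes have distinct values near `p`, hence are
independent, so at most `r + 1` slopes occur. Conversely, a function with `r` prescribed zeros close
to `p` bends `r` times and so uses generators of `r + 1` slopes (`IsMinOf.exists_card_slopes`).

Total rankability: let `F` be the functions with position at least `x`, and let `T ⊆ F` realise each
slope of `F` along `η` once. Condition (3) puts `T` in a subseries of rank `T.card - 1`. Any further
member is dependent on `T`, so along no direction does it fall below all of `T`
(`exists_slope_le_of_dependent_insert`). The subseries therefore stays in `F`, which then has at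
least `T.card` slopes in every direction; symmetry gives equality.

Existence: spread the chips of `A` at `p` over `A p` distinct points within distance `t`, and take
`h t` in the series for this divisor. A cluster point of the coefficients of `h t` as `t` tends to
`0` defines `f`. For suitable small `t`, the generators minimising `h t` at `p` and at the nearby
chips also minimise `f` at `p`. They have `A p + 1` slopes along one ray, and none has a slope at
`p` below that of `f`. This yields both the local rank and the order of `f`
(`IsTLS.exists_generic`). -/

namespace MetricGraph

variable {V E : Type*} {Γ : MetricGraph V E}

/-! ### Points, tangent vectors and rays -/

theorem edgePoint_of_mem {e : E} {t : ℝ} (h : t ∈ Set.Ioo 0 (Γ.len e)) :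
    Γ.edgePoint e t = .interior e ⟨t, h⟩ := by
  rw [edgePoint, dif_pos h]

theorem edgePoint_zero (e : E) : Γ.edgePoint e 0 = .vertex (Γ.src e) := by
  simp [edgePoint]

theorem edgePoint_len (e : E) : Γ.edgePoint e (Γ.len e) = .vertex (Γ.tgt e) := by
  have := Γ.len_pos e
  simp [edgePoint, this]

/-- A vertex may be an endpoint of several edges, but an interior point remembers its edge and
parameter. This is why rays are kept inside open edges below. -/
theorem edgePoint_eq_interior {e e' : E} {t t' : ℝ} (h : t ∈ Set.Ioo 0 (Γ.len e))
    (h' : Γ.edgePoint e' t' = Γ.edgePoint e t) : e' = e ∧ t' = t := by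
  rw [edgePoint_of_mem h] at h'
  unfold edgePoint at h'
  split_ifs at h' with h1
  injection h' with h2 h3
  subst h2
  exact ⟨rfl, by simpa using h3⟩

/-- Without isolated vertices, every point lies on an edge. -/
theorem exists_edgePoint_eq (hΓ : ∀ v : V, ∃ e : E, Γ.src e = v ∨ Γ.tgt e = v) (p : Γ.Point) :
    ∃ e, ∃ t ∈ Set.Icc 0 (Γ.len e), Γ.edgePoint e t = p := by
  cases p with
  | vertex v =>
    obtain ⟨e, rfl | rfl⟩ := hΓ v
    · exact ⟨e, 0, ⟨le_rfl, (Γ.len_pos e).le⟩, edgePoint_zero e⟩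
    · exact ⟨e, Γ.len e, ⟨(Γ.len_pos e).le, le_rfl⟩, edgePoint_len e⟩
  | interior e t => exact ⟨e, t, ⟨t.2.1.le, t.2.2.le⟩, edgePoint_of_mem t.2⟩

theorem nonempty_tangent (hΓ : ∀ v : V, ∃ e : E, Γ.src e = v ∨ Γ.tgt e = v) (p : Γ.Point) :
    Nonempty (Γ.Tangent p) := by
  obtain ⟨e, t, ht, hp⟩ := exists_edgePoint_eq hΓ p
  rcases ht.2.lt_or_eq with h | h
  · exact ⟨⟨e, true, t, ht, by simpa using h, hp⟩⟩
  · exact ⟨⟨e, false, t, ht, by simpa [h] using Γ.len_pos e, hp⟩⟩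

@[simp]
theorem Tangent.ray_zero {p : Γ.Point} (η : Γ.Tangent p) : η.ray 0 = p := by
  simp [Tangent.ray, η.point_eq]

/-- The parameter on the edge of `η` of the point at distance `s`. -/
noncomputable def Tangent.param {p : Γ.Point} (η : Γ.Tangent p) (s : ℝ) : ℝ :=
  if η.fwd then η.t + s else η.t - s

theorem Tangent.ray_eq {p : Γ.Point} (η : Γ.Tangent p) (s : ℝ) :
    η.ray s = Γ.edgePoint η.e (η.param s) := rfl

theorem Tangent.param_injective {p : Γ.Point} (η : Γ.Tangent p) :
    Function.Injective η.param := by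
  intro s t h
  unfold Tangent.param at h
  split_ifs at h <;> linarith

theorem Tangent.eventually_param_mem {p : Γ.Point} (η : Γ.Tangent p) :
    ∀ᶠ s in 𝓝[>] (0 : ℝ), η.param s ∈ Set.Ioo 0 (Γ.len η.e) := by
  obtain ⟨e, b, t, ht, hr, rfl⟩ := η
  cases b
  · simp only [Bool.false_eq_true, if_false] at hr
    filter_upwards [Ioo_mem_nhdsGT hr] with s hs
    simp only [Tangent.param, Bool.false_eq_true, if_false]
    exact ⟨by linarith [hs.2], by linarith [hs.1, ht.2]⟩
  · simp only [if_true] at hr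
    filter_upwards [Ioo_mem_nhdsGT (sub_pos.2 hr)] with s hs
    simp only [Tangent.param, if_true]
    exact ⟨by linarith [hs.1, ht.1], by linarith [hs.2]⟩

theorem Tangent.eventually_ray_ne {p : Γ.Point} (η : Γ.Tangent p) (q : Γ.Point) :
    ∀ᶠ s in 𝓝[>] (0 : ℝ), η.ray s ≠ q := by
  by_cases h : ∃ s₀ > 0, η.param s₀ ∈ Set.Ioo 0 (Γ.len η.e) ∧ η.ray s₀ = q
  · obtain ⟨s₀, h0, hm, rfl⟩ := h
    filter_upwards [Ioo_mem_nhdsGT h0] with s hs heq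
    exact hs.2.ne (η.param_injective (edgePoint_eq_interior hm heq).2)
  · filter_upwards [η.eventually_param_mem, self_mem_nhdsWithin] with s hs h0 heq
    exact h ⟨s, h0, hs, heq⟩

/-! ### Orders at interior points of edges -/

/-- The tangent vector in direction `b` at an interior point of an edge. -/
def interiorTangent (e : E) {u : ℝ} (hu : u ∈ Set.Ioo 0 (Γ.len e)) (b : Bool) :
    Γ.Tangent (Γ.edgePoint e u) where
  e := e
  fwd := b
  t := u
  mem := ⟨hu.1.le, hu.2.le⟩
  room := by cases b <;> simp [hu.1, hu.2]
  point_eq := rfl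

theorem interiorTangent_bijective (e : E) {u : ℝ} (hu : u ∈ Set.Ioo 0 (Γ.len e)) :
    Function.Bijective (interiorTangent e hu) := by
  constructor
  · intro b b' h
    exact congrArg Tangent.fwd h
  · intro η
    obtain ⟨h1, h2⟩ := edgePoint_eq_interior hu η.point_eq
    exact ⟨η.fwd, Tangent.ext h1.symm rfl h2.symm⟩

/-- There are just two tangent vectors, and the slopes `m` and `-m` along them cancel.
Contrapositively, a nonzero order detects a bend. -/
theorem ord_edgePoint_eq_zero {f : Γ.Point → ℝ} {e : E} {u : ℝ} {m : ℤ}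
    (hu : u ∈ Set.Ioo 0 (Γ.len e))
    (h : ∀ᶠ v in 𝓝 u, f (Γ.edgePoint e v) = f (Γ.edgePoint e u) + m * (v - u)) :
    ord f (Γ.edgePoint e u) = 0 := by
  have h1 : slope f (interiorTangent e hu true) = m := by
    refine HasSlope.slope_eq ?_
    have ht : Filter.Tendsto (fun s : ℝ => u + s) (𝓝[>] 0) (𝓝 u) := by
      refine Filter.Tendsto.mono_left ?_ nhdsWithin_le_nhds
      exact Continuous.tendsto' (by fun_prop) _ _ (by simp)
    filter_upwards [ht.eventually h] with s hs
    simpa [Tangent.ray, interiorTangent] using hs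
  have h2 : slope f (interiorTangent e hu false) = -m := by
    refine HasSlope.slope_eq ?_
    have ht : Filter.Tendsto (fun s : ℝ => u - s) (𝓝[>] 0) (𝓝 u) := by
      refine Filter.Tendsto.mono_left ?_ nhdsWithin_le_nhds
      exact Continuous.tendsto' (by fun_prop) _ _ (by simp)
    filter_upwards [ht.eventually h] with s hs
    simpa [Tangent.ray, interiorTangent] using hs
  rw [ord, ← finsum_eq_of_bijective (f := fun b => slope f (interiorTangent e hu b)) _
    (interiorTangent_bijective e hu) (fun _ => rfl), finsum_eq_sum_of_fintype, Fintype.sum_bool,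
    h1, h2]
  ring

theorem ord_ray_eq_zero {f : Γ.Point → ℝ} {p : Γ.Point} {η : Γ.Tangent p} {s : ℝ} {m : ℤ}
    (hs : η.param s ∈ Set.Ioo 0 (Γ.len η.e))
    (h : ∀ᶠ v in 𝓝 s, f (η.ray v) = f (η.ray s) + m * (v - s)) : ord f (η.ray s) = 0 := by
  simp only [Tangent.ray_eq] at h ⊢
  cases hb : η.fwd
  · refine ord_edgePoint_eq_zero (m := -m) hs ?_
    simp only [Tangent.param, hb, Bool.false_eq_true, if_false] at h ⊢
    have ht : Filter.Tendsto (fun v : ℝ => η.t - v) (𝓝 (η.t - s)) (𝓝 s) :=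
      Continuous.tendsto' (by fun_prop) _ _ (by simp)
    filter_upwards [ht.eventually h] with v hv
    rw [sub_sub_cancel] at hv
    rw [hv]
    push_cast
    ring
  · refine ord_edgePoint_eq_zero (m := m) hs ?_
    simp only [Tangent.param, hb, if_true] at h ⊢
    have ht : Filter.Tendsto (fun v : ℝ => v - η.t) (𝓝 (η.t + s)) (𝓝 s) :=
      Continuous.tendsto' (by fun_prop) _ _ (by simp)
    filter_upwards [ht.eventually h] with v hv
    rw [add_sub_cancel] at hv
    rw [hv]
    ring

/-! ### Slopes -/

theorem slope_add_const (f : Γ.Point → ℝ) (c : ℝ) {p : Γ.Point} (η : Γ.Tangent p) :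
    slope (fun q => f q + c) η = slope f η := by
  have h (m : ℤ) : HasSlope (fun q => f q + c) η m ↔ HasSlope f η m := by
    refine Filter.eventually_congr (.of_forall fun s => ?_)
    constructor <;> intro h <;> linarith
  by_cases hm : ∃ m, HasSlope f η m
  · obtain ⟨m, hm⟩ := hm
    rw [hm.slope_eq, ((h m).2 hm).slope_eq]
  · rw [slope, slope, dif_neg hm, dif_neg (by simpa only [h] using hm)]

theorem ord_add_const (f : Γ.Point → ℝ) (c : ℝ) (p : Γ.Point) :
    ord (fun q => f q + c) p = ord f p := by
  simp only [ord, slope_add_const]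

/-- Applied to a minimum `f` and a term attaining it at `p`: such a term has slopes at least those
of `f` in every direction. -/
theorem slope_le_slope_of_le {f g : Γ.Point → ℝ} (hf : IsPL f) (hg : IsPL g) {p : Γ.Point}
    (η : Γ.Tangent p) {c : ℝ} (hle : ∀ q, f q ≤ g q + c) (hp : f p = g p + c) :
    slope f η ≤ slope g η := by
  obtain ⟨s, ⟨h1, h2⟩, hs⟩ :=
    ((hf.hasSlope η).and (hg.hasSlope η)).and self_mem_nhdsWithin |>.exists
  have h := hle (η.ray s)
  rw [h1, h2, hp] at h
  have : (slope f η : ℝ) * s ≤ slope g η * s := by linarith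
  exact_mod_cast le_of_mul_le_mul_right this hs

theorem IsPL.exists_bound [Finite E] (hΓ : ∀ v : V, ∃ e : E, Γ.src e = v ∨ Γ.tgt e = v)
    {f : Γ.Point → ℝ} (hf : IsPL f) : ∃ C, ∀ p, |f p| ≤ C := by
  have h (e : E) : ∃ C, ∀ t ∈ Set.Icc 0 (Γ.len e), |f (Γ.edgePoint e t)| ≤ C := by
    obtain ⟨C, hC⟩ := isCompact_Icc.exists_bound_of_continuousOn (hf e).1
    exact ⟨C, hC⟩
  choose C hC using h
  obtain ⟨B, hB⟩ := (Set.finite_range C).bddAbove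
  refine ⟨B, fun p => ?_⟩
  obtain ⟨e, t, ht, rfl⟩ := exists_edgePoint_eq hΓ p
  exact (hC e t ht).trans (hB ⟨e, rfl⟩)

/-! ### Tropical linear combinations -/

/-- `f` is the minimum of the functions `g + a g` for `g ∈ G`. -/
def IsMinOf (G : Finset (Γ.Point → ℝ)) (a : (Γ.Point → ℝ) → ℝ) (f : Γ.Point → ℝ) : Prop :=
  ∀ p, (∀ g ∈ G, f p ≤ g p + a g) ∧ ∃ g ∈ G, f p = g p + a g

theorem isMinOf_inf' {T : Finset (Γ.Point → ℝ)} (hT : T.Nonempty) (a : (Γ.Point → ℝ) → ℝ) :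
    IsMinOf T a fun p => T.inf' hT fun g => g p + a g := fun _ =>
  ⟨fun _ hg => Finset.inf'_le _ hg, Finset.exists_mem_eq_inf' hT _⟩

theorem IsMinOf.eq_inf' {T : Finset (Γ.Point → ℝ)} {a : (Γ.Point → ℝ) → ℝ} {f : Γ.Point → ℝ}
    (h : IsMinOf T a f) (hT : T.Nonempty) (p : Γ.Point) : f p = T.inf' hT fun g => g p + a g := by
  obtain ⟨g, hg, hp⟩ := (h p).2
  exact le_antisymm (Finset.le_inf' _ _ (h p).1) (hp ▸ Finset.inf'_le _ hg)

theorem subset_tropicalSpan (G : Set (Γ.Point → ℝ)) : G ⊆ tropicalSpan G := fun g hg =>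
  ⟨{g}, Finset.singleton_nonempty g, 0, by simpa using hg, by simp⟩

theorem exists_isMinOf_of_mem_tropicalSpan {G : Set (Γ.Point → ℝ)} {f : Γ.Point → ℝ}
    (hf : f ∈ tropicalSpan G) : ∃ (T : Finset (Γ.Point → ℝ)) (a : (Γ.Point → ℝ) → ℝ),
      (T : Set (Γ.Point → ℝ)) ⊆ G ∧ IsMinOf T a f := by
  obtain ⟨T, hT, a, hTG, h⟩ := hf
  exact ⟨T, a, hTG, funext h ▸ isMinOf_inf' hT a⟩

theorem add_const_mem_tropicalSpan {G : Set (Γ.Point → ℝ)} {f : Γ.Point → ℝ}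
    (hf : f ∈ tropicalSpan G) (c : ℝ) : (fun p => f p + c) ∈ tropicalSpan G := by
  obtain ⟨T, hT, a, hTG, h⟩ := hf
  have h' : IsMinOf T a f := funext h ▸ isMinOf_inf' hT a
  refine ⟨T, hT, fun g => a g + c, hTG, IsMinOf.eq_inf' (fun p => ⟨fun g hg => ?_, ?_⟩) hT⟩
  · linarith [(h' p).1 g hg]
  · obtain ⟨g, hg, hp⟩ := (h' p).2
    exact ⟨g, hg, by linarith⟩

/-- Up to a constant, the coefficients of a tropical linear combination of a finite set of bounded
functions can be taken from a fixed compact interval. -/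
theorem exists_bounded_isMinOf {G : Finset (Γ.Point → ℝ)} (hG : ∀ g ∈ G, ∃ C, ∀ p, |g p| ≤ C) :
    ∃ C : ℝ, ∀ f ∈ tropicalSpan (G : Set (Γ.Point → ℝ)), ∃ (c : ℝ) (a : (Γ.Point → ℝ) → ℝ),
      (∀ g, a g ∈ Set.Icc 0 C) ∧ IsMinOf G a fun p => f p + c := by
  obtain ⟨B, hB⟩ : ∃ B, ∀ g ∈ G, ∀ p, |g p| ≤ B := by
    choose! C hC using hG
    obtain ⟨B, hB⟩ := (G.finite_toSet.image C).bddAbove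
    exact ⟨B, fun g hg p => (hC g hg p).trans (hB ⟨g, hg, rfl⟩)⟩
  refine ⟨2 * |B|, ?_⟩
  rintro f ⟨T, hT, a, hTG, h⟩
  have h' : IsMinOf T a f := funext h ▸ isMinOf_inf' hT a
  obtain ⟨j, hj, hmin⟩ := T.exists_min_image a hT
  classical
  have hB0 := abs_nonneg B
  have key (g : Γ.Point → ℝ) (hg : g ∈ G) (p : Γ.Point) : f p - a j ≤ g p + 2 * |B| := by
    have h1 := abs_le.1 (hB g hg p)
    have h2 := abs_le.1 (hB j (hTG hj) p)
    have h3 := (h' p).1 j hj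
    linarith [le_abs_self B]
  -- Shifting by `-a j` makes the smallest coefficient `0`. Then `f - a j ≤ j ≤ |B| ≤ g + 2 * |B|`,
  -- so capping coefficients at `2 * |B|`, and giving this value to the functions outside `T`,
  -- leaves the minimum unchanged.
  refine ⟨-a j, fun g => if g ∈ T then min (a g - a j) (2 * |B|) else 2 * |B|, fun g => ?_,
    fun p => ⟨fun g hg => ?_, ?_⟩⟩
  · dsimp only
    split_ifs with hg
    · exact ⟨le_min (sub_nonneg.2 (hmin g hg)) (by positivity), min_le_right _ _⟩
    · exact ⟨by positivity, le_rfl⟩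
  · dsimp only
    split_ifs with hg'
    · rw [← min_add_add_left]
      exact le_min (by linarith [(h' p).1 g hg']) (by linarith [key g hg p])
    · linarith [key g hg p]
  · obtain ⟨g, hg, hp⟩ := (h' p).2
    refine ⟨g, hTG hg, ?_⟩
    dsimp only
    rw [if_pos hg, min_eq_left (by linarith [key g (hTG hg) p])]
    linarith

/-! ### Slopes and bends of a minimum -/

/-- The slope of a minimum along `η` is the slope of a function attaining it at the base point. -/
theorem IsMinOf.exists_slope_eq {G : Finset (Γ.Point → ℝ)} {a : (Γ.Point → ℝ) → ℝ}
    {f : Γ.Point → ℝ} (h : IsMinOf G a f) (hf : IsPL f) (hG : ∀ g ∈ G, IsPL g) {p : Γ.Point}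
    (η : Γ.Tangent p) : ∃ g ∈ G, f p = g p + a g ∧ slope g η = slope f η := by
  -- By finiteness one `g` attains the minimum at points arbitrarily close to `p`. Two such
  -- coincidences of germs affine in `s` identify both slope and value.
  have h1 : ∃ g ∈ G, ∃ᶠ s in 𝓝[>] (0 : ℝ), f (η.ray s) = g (η.ray s) + a g := by
    by_contra! hc
    obtain ⟨s, hs⟩ := ((Filter.eventually_all_finset G).2 hc).exists
    obtain ⟨g, hg, he⟩ := (h (η.ray s)).2
    exact hs g hg he
  obtain ⟨g, hg, hfr⟩ := h1
  have hfr := hfr.and_eventually (((hf.hasSlope η).and ((hG g hg).hasSlope η)).and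
    self_mem_nhdsWithin)
  obtain ⟨s, h1, ⟨h2, h3⟩, hs⟩ := hfr.exists
  obtain ⟨s', ⟨h1', ⟨h2', h3'⟩, hs'⟩, hlt⟩ := (hfr.and_eventually (Ioo_mem_nhdsGT hs)).exists
  have e1 : f p + slope f η * s = g p + slope g η * s + a g := by rw [← h2, ← h3, h1]
  have e2 : f p + slope f η * s' = g p + slope g η * s' + a g := by rw [← h2', ← h3', h1']
  have e3 : ((slope f η : ℝ) - slope g η) * (s - s') = 0 := by linear_combination e1 - e2
  have e4 : (slope f η : ℝ) = slope g η := by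
    rcases mul_eq_zero.1 e3 with h | h
    · linarith
    · linarith [hlt.2]
  refine ⟨g, hg, ?_, by exact_mod_cast e4.symm⟩
  rw [e4] at e1
  linarith

/-- If the functions in `G` are affine along `η` on `[0, ε)`, then at a point of this segment at
which their minimum bends, the minimum is attained with two different slopes. -/
theorem IsMinOf.exists_slope_lt_slope {G : Finset (Γ.Point → ℝ)} {a : (Γ.Point → ℝ) → ℝ}
    {f : Γ.Point → ℝ} (h : IsMinOf G a f) {p : Γ.Point} {η : Γ.Tangent p} {ε s : ℝ}
    (hlin : ∀ g ∈ G, ∀ s ∈ Set.Ico 0 ε, g (η.ray s) = g p + slope g η * s)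
    (hs : s ∈ Set.Ioo 0 ε) (hsm : η.param s ∈ Set.Ioo 0 (Γ.len η.e)) (hord : ord f (η.ray s) ≠ 0) :
    ∃ g ∈ G, ∃ g' ∈ G, f (η.ray s) = g (η.ray s) + a g ∧ f (η.ray s) = g' (η.ray s) + a g' ∧
      slope g η < slope g' η := by
  by_contra! hc
  obtain ⟨g₀, hg₀, h₀⟩ := (h (η.ray s)).2
  refine hord (ord_ray_eq_zero (m := slope g₀ η) hsm ?_)
  have hs' : s ∈ Set.Ico 0 ε := ⟨hs.1.le, hs.2⟩
  -- Terms attaining the minimum near `s` already attain it at `s`. If all of those share one slope,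
  -- `f` is affine around `s` and has order zero there.
  have h1 : ∀ g ∈ G, ∀ᶠ v in 𝓝 s, f (η.ray v) = g (η.ray v) + a g →
      f (η.ray s) = g (η.ray s) + a g := by
    intro g hg
    by_cases hgs : f (η.ray s) = g (η.ray s) + a g
    · exact .of_forall fun _ _ => hgs
    · have hlt : g₀ p + slope g₀ η * s + a g₀ < g p + slope g η * s + a g := by
        rw [← hlin g hg s hs', ← hlin g₀ hg₀ s hs', ← h₀]
        exact lt_of_le_of_ne ((h _).1 g hg) hgs
      have hev : ∀ᶠ v in 𝓝 s, g₀ p + slope g₀ η * v + a g₀ < g p + slope g η * v + a g :=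
        ContinuousAt.eventually_lt (by fun_prop) (by fun_prop) hlt
      filter_upwards [hev, Ioo_mem_nhds hs.1 hs.2] with v hv hvε heq
      have hv' : v ∈ Set.Ico 0 ε := ⟨hvε.1.le, hvε.2⟩
      rw [← hlin g hg v hv', ← hlin g₀ hg₀ v hv'] at hv
      linarith [(h (η.ray v)).1 g₀ hg₀]
  filter_upwards [(Filter.eventually_all_finset G).2 h1, Ioo_mem_nhds hs.1 hs.2] with v hv hvε
  have hv' : v ∈ Set.Ico 0 ε := ⟨hvε.1.le, hvε.2⟩
  obtain ⟨g, hg, he⟩ := (h (η.ray v)).2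
  have hgs := hv g hg he
  have hslope : slope g η = slope g₀ η :=
    le_antisymm (hc g₀ hg₀ g hg h₀ hgs) (hc g hg g₀ hg₀ hgs h₀)
  rw [he, hgs, hlin g hg v hv', hlin g hg s hs', hslope]
  ring

/-- If the minimum of the functions in `G` bends at `n` points near `p` along `η`, then `n + 1`
different slopes, none greater than the initial one, occur among the functions attaining it. -/
theorem IsMinOf.exists_card_slopes {G : Finset (Γ.Point → ℝ)} {a : (Γ.Point → ℝ) → ℝ}
    {f : Γ.Point → ℝ} (h : IsMinOf G a f) (hf : IsPL f) (hG : ∀ g ∈ G, IsPL g) {p : Γ.Point}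
    {η : Γ.Tangent p} {ε : ℝ}
    (hlin : ∀ g ∈ G, ∀ s ∈ Set.Ico 0 ε, g (η.ray s) = g p + slope g η * s)
    (hmem : ∀ s ∈ Set.Ioo 0 ε, η.param s ∈ Set.Ioo 0 (Γ.len η.e)) {S : Finset ℝ}
    (hS : ∀ s ∈ S, s ∈ Set.Ioo 0 ε ∧ ord f (η.ray s) ≠ 0) :
    ∃ W : Finset ℤ, W.card = S.card + 1 ∧ ∀ m ∈ W, m ≤ slope f η ∧
      ∃ g ∈ G, slope g η = m ∧ ∃ s ∈ insert 0 S, f (η.ray s) = g (η.ray s) + a g := by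
  classical
  choose! φ hφ ψ hψ hφs hψs hlt using fun s (hs : s ∈ S) =>
    h.exists_slope_lt_slope hlin (hS s hs).1 (hmem s (hS s hs).1) (hS s hs).2
  obtain ⟨g₀, hg₀, h₀, hsl⟩ := h.exists_slope_eq hf hG η
  -- Concavity: the slopes of the minimising terms do not increase with `s`. With the strict drop
  -- from `ψ s` to `φ s` at each bend, the slopes of the `φ s` are distinct and below the initial
  -- one.
  have anti : ∀ g ∈ G, ∀ g' ∈ G, ∀ s ∈ Set.Ico 0 ε, ∀ s' ∈ Set.Ico 0 ε, s < s' →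
      f (η.ray s) = g (η.ray s) + a g → f (η.ray s') = g' (η.ray s') + a g' →
      slope g' η ≤ slope g η := by
    intro g hg g' hg' s hs s' hs' hss he he'
    have h1 := (h (η.ray s)).1 g' hg'
    have h2 := (h (η.ray s')).1 g hg
    rw [he, hlin g hg s hs, hlin g' hg' s hs] at h1
    rw [he', hlin g hg s' hs', hlin g' hg' s' hs'] at h2
    have h3 : (slope g' η : ℝ) * (s' - s) ≤ slope g η * (s' - s) := by linarith
    exact_mod_cast le_of_mul_le_mul_right h3 (sub_pos.2 hss)
  have hIco (s : ℝ) (hs : s ∈ S) : s ∈ Set.Ico 0 ε := ⟨(hS s hs).1.1.le, (hS s hs).1.2⟩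
  have hlt0 (s : ℝ) (hs : s ∈ S) : slope (φ s) η < slope f η := by
    refine (hlt s hs).trans_le (hsl ▸ ?_)
    have h0 : (0 : ℝ) ∈ Set.Ico 0 ε := ⟨le_rfl, (hS s hs).1.1.trans (hS s hs).1.2⟩
    exact anti g₀ hg₀ _ (hψ s hs) 0 h0 s (hIco s hs) (hS s hs).1.1 (by simpa using h₀) (hψs s hs)
  have hanti (s : ℝ) (hs : s ∈ S) (s' : ℝ) (hs' : s' ∈ S) (hss : s < s') :
      slope (φ s') η < slope (φ s) η :=
    (hlt s' hs').trans_le (anti _ (hφ s hs) _ (hψ s' hs') s (hIco s hs) s' (hIco s' hs') hss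
      (hφs s hs) (hψs s' hs'))
  refine ⟨insert (slope f η) (S.image fun s => slope (φ s) η), ?_, fun m hm => ?_⟩
  · rw [Finset.card_insert_of_notMem, Finset.card_image_of_injOn]
    · intro s hs s' hs' he
      rcases lt_trichotomy s s' with hss | hss | hss
      · exact absurd he (hanti s hs s' hs' hss).ne'
      · exact hss
      · exact absurd he (hanti s' hs' s hs hss).ne
    · intro hm
      obtain ⟨s, hs, he⟩ := Finset.mem_image.1 hm
      exact (hlt0 s hs).ne he
  · rcases Finset.mem_insert.1 hm with rfl | hm
    · exact ⟨le_rfl, g₀, hg₀, hsl, 0, Finset.mem_insert_self _ _, by simpa using h₀⟩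
    · obtain ⟨s, hs, rfl⟩ := Finset.mem_image.1 hm
      exact ⟨(hlt0 s hs).le, φ s, hφ s hs, rfl, s, Finset.mem_insert_of_mem hs, hφs s hs⟩

/-- Near its base point, a ray runs in the interior of an edge, avoids the support of a divisor, and
finitely many piecewise linear functions are affine along it. -/
theorem Tangent.exists_segment {p : Γ.Point} (η : Γ.Tangent p) (D : Γ.Divisor)
    {G : Finset (Γ.Point → ℝ)} (hG : ∀ g ∈ G, IsPL g) :
    ∃ ε > 0, (∀ g ∈ G, ∀ s ∈ Set.Ico 0 ε, g (η.ray s) = g p + slope g η * s) ∧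
      (∀ s ∈ Set.Ioo 0 ε, η.param s ∈ Set.Ioo 0 (Γ.len η.e)) ∧
      ∀ s ∈ Set.Ioo 0 ε, D (η.ray s) = 0 := by
  have h1 := (Filter.eventually_all_finset G).2 fun g hg => (hG g hg).hasSlope η
  have h2 := (Filter.eventually_all_finset D.support).2 fun q _ => η.eventually_ray_ne q
  obtain ⟨ε, hε, hsub⟩ :=
    mem_nhdsGT_iff_exists_Ioo_subset.1 ((h1.and h2).and η.eventually_param_mem)
  refine ⟨ε, hε, fun g hg s hs => ?_, fun s hs => (hsub hs).2, fun s hs => ?_⟩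
  · rcases hs.1.eq_or_lt with rfl | h0
    · simp
    · exact (hsub ⟨h0, hs.2⟩).1.1 g hg
  · by_contra hne
    exact (hsub hs).1.2 _ (Finsupp.mem_support_iff.2 hne) rfl

/-! ### Sums of points -/

theorem deg_sum_single {ι : Type*} (s : Finset ι) (q : ι → Γ.Point) :
    deg (∑ i ∈ s, Finsupp.single (q i) (1 : ℤ)) = s.card := by
  rw [deg, ← Finsupp.sum_finsetSum_index (fun _ => rfl) (fun _ _ _ => rfl)]
  simp

theorem sum_single_nonneg {ι : Type*} (s : Finset ι) (q : ι → Γ.Point) :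
    0 ≤ ∑ i ∈ s, Finsupp.single (q i) (1 : ℤ) :=
  Finset.sum_nonneg fun _ _ => Finsupp.single_nonneg.2 zero_le_one

theorem one_le_sum_single {ι : Type*} {s : Finset ι} (q : ι → Γ.Point) {i : ι} (hi : i ∈ s) :
    1 ≤ (∑ i ∈ s, Finsupp.single (q i) (1 : ℤ)) (q i) := by
  have h := Finset.single_le_sum (f := fun i => Finsupp.single (q i) (1 : ℤ))
    (fun _ _ => Finsupp.single_nonneg.2 zero_le_one) hi
  simpa using h (q i)

/-! ### Tropical dependence and slopes -/

theorem exists_finset_of_subset_image {α β : Type*} {F : Set α} {u : α → β} {W : Finset β}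
    (hW : (W : Set β) ⊆ u '' F) :
    ∃ T : Finset α, (T : Set α) ⊆ F ∧ T.card = W.card ∧ Set.InjOn u T := by
  classical
  choose v hvF hv using hW
  refine ⟨W.attach.image fun x => v x.2, ?_, ?_, ?_⟩
  · rw [Finset.coe_image]
    rintro _ ⟨x, -, rfl⟩
    exact hvF x.2
  · rw [Finset.card_image_of_injective, Finset.card_attach]
    intro x y h
    exact Subtype.ext (by rw [← hv x.2, ← hv y.2]; exact congrArg u h)
  · rw [Finset.coe_image]
    rintro _ ⟨x, -, rfl⟩ _ ⟨y, -, rfl⟩ h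
    dsimp only at h ⊢
    rw [hv, hv] at h
    rw [Subtype.ext h]

theorem IsPL.tendsto_ray {f : Γ.Point → ℝ} (hf : IsPL f) {p : Γ.Point} (η : Γ.Tangent p) :
    Filter.Tendsto (fun s => f (η.ray s)) (𝓝[>] 0) (𝓝 (f p)) := by
  have h : Filter.Tendsto (fun s : ℝ => f p + slope f η * s) (𝓝[>] 0) (𝓝 (f p)) :=
    (Continuous.tendsto' (by fun_prop) _ _ (by simp)).mono_left nhdsWithin_le_nhds
  exact h.congr' ((hf.hasSlope η).mono fun s hs => hs.symm)

theorem eventually_add_ne_add {f g : Γ.Point → ℝ} (hf : IsPL f) (hg : IsPL g) {p : Γ.Point}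
    {η : Γ.Tangent p} (h : slope f η ≠ slope g η) (a b : ℝ) :
    ∀ᶠ s in 𝓝[>] (0 : ℝ), f (η.ray s) + a ≠ g (η.ray s) + b := by
  have h' : (slope f η : ℝ) - slope g η ≠ 0 := sub_ne_zero.2 (by exact_mod_cast h)
  -- The excluded value is the only parameter at which the two affine germs can cross.
  have h0 : ∀ᶠ s in 𝓝[>] (0 : ℝ), s ≠ (g p + b - f p - a) / (slope f η - slope g η) := by
    rcases le_or_gt ((g p + b - f p - a) / ((slope f η : ℝ) - slope g η)) 0 with hle | hlt
    · filter_upwards [self_mem_nhdsWithin] with s hs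
      exact (hle.trans_lt hs).ne'
    · filter_upwards [Ioo_mem_nhdsGT hlt] with s hs
      exact hs.2.ne
  filter_upwards [h0, hf.hasSlope η, hg.hasSlope η] with s hs h1 h2 he
  rw [h1, h2] at he
  exact hs (by rw [eq_div_iff h']; linarith)

theorem eventually_pairwise_add_ne_add {T : Finset (Γ.Point → ℝ)} (hT : ∀ f ∈ T, IsPL f)
    {p : Γ.Point} {η : Γ.Tangent p} (hinj : Set.InjOn (fun f => slope f η) T)
    (a : (Γ.Point → ℝ) → ℝ) : ∀ᶠ s in 𝓝[>] (0 : ℝ), ∀ f ∈ T, ∀ g ∈ T, f ≠ g →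
      f (η.ray s) + a f ≠ g (η.ray s) + a g := by
  simp only [Filter.eventually_all_finset]
  intro f hf g hg
  by_cases h : f = g
  · simp [h]
  · exact (eventually_add_ne_add (hT f hf) (hT g hg) (fun he => h (hinj hf hg he)) _ _).mono
      fun _ hs _ => hs

theorem not_tropicallyDependent_of_injOn {T : Finset (Γ.Point → ℝ)} (hT : ∀ f ∈ T, IsPL f)
    {p : Γ.Point} {η : Γ.Tangent p} (hinj : Set.InjOn (fun f => slope f η) T) :
    ¬ TropicallyDependent T := by
  rintro ⟨a, ha⟩
  have hne := eventually_pairwise_add_ne_add hT hinj a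
  obtain ⟨s, hs⟩ := hne.exists
  obtain ⟨f, hf, g, hg, hfg, he, -⟩ := ha (η.ray s)
  exact hs f hf g hg hfg he

/-- If the functions in `T` have different slopes along `η` and become dependent together with `h`,
then along no tangent vector at the same point is the slope of `h` less than all slopes of `T`. -/
theorem exists_slope_le_of_dependent_insert [DecidableEq (Γ.Point → ℝ)]
    {T : Finset (Γ.Point → ℝ)} {h : Γ.Point → ℝ} (hT : ∀ f ∈ T, IsPL f) (hh : IsPL h)
    {p : Γ.Point} {η : Γ.Tangent p} (hinj : Set.InjOn (fun f => slope f η) T)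
    (hdep : TropicallyDependent (insert h T)) (θ : Γ.Tangent p) :
    ∃ f ∈ T, slope f θ ≤ slope h θ := by
  obtain ⟨a, ha⟩ := hdep
  have hne := eventually_pairwise_add_ne_add hT hinj a
  -- Close to `p` along `η` no two members of `T` tie, so `h` belongs to every tying pair; by
  -- continuity `h` attains the minimum at `p`. If `h` had the smallest slope along `θ`, it would be
  -- the only minimiser just after `p`.
  have hmin : ∀ f ∈ T, h p + a h ≤ f p + a f := by
    intro f hf
    refine le_of_tendsto_of_tendsto ((hh.tendsto_ray η).add_const (a h))
      (((hT f hf).tendsto_ray η).add_const (a f)) ?_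
    filter_upwards [hne] with s hs
    obtain ⟨u, hu, v, hv, huv, he, hle⟩ := ha (η.ray s)
    rcases Finset.mem_insert.1 hu with rfl | hu
    · exact hle f (Finset.mem_insert_of_mem hf)
    · rcases Finset.mem_insert.1 hv with rfl | hv
      · exact he ▸ hle f (Finset.mem_insert_of_mem hf)
      · exact absurd he (hs u hu v hv huv)
  by_contra! hlt
  have hev : ∀ᶠ s in 𝓝[>] (0 : ℝ), ∀ f ∈ T, h (θ.ray s) + a h < f (θ.ray s) + a f := by
    refine (Filter.eventually_all_finset T).2 fun f hf => ?_
    filter_upwards [hh.hasSlope θ, (hT f hf).hasSlope θ, self_mem_nhdsWithin] with s h1 h2 hs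
    have h3 : (slope h θ : ℝ) < slope f θ := by exact_mod_cast hlt f hf
    have h4 := mul_lt_mul_of_pos_right h3 hs
    linarith [hmin f hf]
  obtain ⟨s, hs⟩ := hev.exists
  obtain ⟨u, hu, v, hv, huv, he, hle⟩ := ha (θ.ray s)
  have hle' := hle h (Finset.mem_insert_self _ _)
  rcases Finset.mem_insert.1 hu with rfl | hu
  · rcases Finset.mem_insert.1 hv with rfl | hv
    · exact huv rfl
    · exact absurd he (hs v hv).ne
  · exact absurd hle' (hs u hu).not_ge

/-! ### Tropical linear series -/

theorem IsMinOf.mem_tropicalSpan {T : Finset (Γ.Point → ℝ)} (hT : T.Nonempty)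
    {a : (Γ.Point → ℝ) → ℝ} {f : Γ.Point → ℝ} (h : IsMinOf T a f) :
    f ∈ tropicalSpan (T : Set (Γ.Point → ℝ)) :=
  ⟨T, hT, a, subset_rfl, h.eq_inf' hT⟩

section

variable {D : Γ.Divisor} {r : ℕ} {M : Set (Γ.Point → ℝ)}

theorem IsTLS.isPL (hM : IsTLS D r M) {f : Γ.Point → ℝ} (hf : f ∈ M) : IsPL f :=
  (hM.subset hf).1

theorem IsTLS.exists_generators (hM : IsTLS D r M) :
    ∃ G : Finset (Γ.Point → ℝ), M = tropicalSpan (G : Set (Γ.Point → ℝ)) ∧ ∀ g ∈ G, g ∈ M := by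
  obtain ⟨G, hG, rfl⟩ := hM.fg
  refine ⟨hG.toFinset, by simp, fun g hg => subset_tropicalSpan G (by simpa using hg)⟩

theorem IsTLS.add_const_mem (hM : IsTLS D r M) {f : Γ.Point → ℝ} (hf : f ∈ M) (c : ℝ) :
    (fun p => f p + c) ∈ M := by
  obtain ⟨G, -, rfl⟩ := hM.fg
  exact add_const_mem_tropicalSpan hf c

theorem IsTLS.card_le_of_injOn (hM : IsTLS D r M) {T : Finset (Γ.Point → ℝ)}
    (hT : (T : Set (Γ.Point → ℝ)) ⊆ M) {p : Γ.Point} {η : Γ.Tangent p}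
    (hinj : Set.InjOn (fun f => slope f η) T) : T.card ≤ r + 1 := by
  by_contra! hlt
  obtain ⟨T', hT', hcard⟩ := Finset.exists_subset_card_eq (Nat.succ_le_of_lt hlt)
  have hsub : (T' : Set (Γ.Point → ℝ)) ⊆ T := Finset.coe_subset.2 hT'
  exact not_tropicallyDependent_of_injOn (fun f hf => hM.isPL (hT (hsub hf))) (hinj.mono hsub)
    (hM.dependent T' (hsub.trans hT) hcard)

theorem IsTLS.finite_slopeSet (hM : IsTLS D r M) {p : Γ.Point} (η : Γ.Tangent p) :
    (slopeSet M η).Finite := by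
  by_contra hinf
  obtain ⟨W, hW, hcard⟩ := Set.Infinite.exists_subset_card_eq hinf (r + 2)
  obtain ⟨T, hT, hTW, hinj⟩ := exists_finset_of_subset_image hW
  have := hM.card_le_of_injOn hT hinj
  omega

/-- A tropical linear series of rank `r` has exactly `r + 1` slopes along every tangent vector. -/
theorem IsTLS.ncard_slopeSet (hM : IsTLS D r M) {p : Γ.Point} (η : Γ.Tangent p) :
    (slopeSet M η).ncard = r + 1 := by
  have hfin := hM.finite_slopeSet η
  refine le_antisymm ?_ ?_
  · obtain ⟨T, hT, hTW, hinj⟩ :=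
      exists_finset_of_subset_image (F := M) (u := fun f => slope f η) (W := hfin.toFinset)
        (by simp [slopeSet])
    rw [Set.ncard_eq_toFinset_card _ hfin, ← hTW]
    exact hM.card_le_of_injOn hT hinj
  · obtain ⟨G, hMG, hG⟩ := hM.exists_generators
    obtain ⟨ε, hε, hlin, hmem, hD⟩ := η.exists_segment D fun g hg => hM.isPL (hG g hg)
    -- `D` vanishes at these `r` points, so the rank condition forces positive order, hence a bend,
    -- at each.
    obtain ⟨S, hS, rfl⟩ := (Set.Ioo_infinite hε).exists_subset_card_eq r
    obtain ⟨f, hf, hfS⟩ := hM.rank _ (sum_single_nonneg S η.ray) (deg_sum_single S η.ray)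
    obtain ⟨T, a, hTG, hT⟩ := exists_isMinOf_of_mem_tropicalSpan (hMG ▸ hf)
    obtain ⟨W, hW, hWT⟩ := hT.exists_card_slopes (hM.isPL hf)
      (fun g hg => hM.isPL (hG g (hTG hg))) (fun g hg => hlin g (hTG hg)) hmem (S := S)
      fun s hs => ⟨hS hs, fun h0 => by
        have h1 := hfS (η.ray s)
        rw [h0, hD s (hS hs)] at h1
        have h2 := one_le_sum_single η.ray hs
        omega⟩
    rw [← hW, ← Set.ncard_coe_finset]
    refine Set.ncard_le_ncard (fun m hm => ?_) hfin
    obtain ⟨-, g, hg, rfl, -⟩ := hWT m hm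
    exact ⟨g, hG g (hTG hg), rfl⟩

/-- Passing from `s` to a larger element adds `s` itself to the set counted. Positions and slopes of
members of a series can thus be compared interchangeably. -/
theorem strictMonoOn_ncard_lt {S : Set ℤ} (hS : S.Finite) :
    StrictMonoOn (fun s => {t ∈ S | t < s}.ncard) S := by
  intro s hs t _ hst
  refine Set.ncard_lt_ncard ⟨fun u hu => ⟨hu.1, hu.2.trans hst⟩, fun h => ?_⟩
    (hS.subset (Set.sep_subset _ _))
  exact lt_irrefl s (h ⟨hs, hst⟩).2

theorem IsTLS.position_le_position_iff (hM : IsTLS D r M) {f g : Γ.Point → ℝ} (hf : f ∈ M)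
    (hg : g ∈ M) {p : Γ.Point} (η : Γ.Tangent p) :
    position M p f η ≤ position M p g η ↔ slope f η ≤ slope g η :=
  (strictMonoOn_ncard_lt (hM.finite_slopeSet η)).le_iff_le ⟨f, hf, rfl⟩ ⟨g, hg, rfl⟩

theorem IsTLS.axisRank_principal (hM : IsTLS D r M) {p : Γ.Point} (x : Γ.Tangent p → ℕ)
    (η : Γ.Tangent p) : axisRank (principal (localArray M p) x) η =
      (slopeSet {f ∈ M | x ≤ position M p f} η).ncard - 1 := by
  have hsub : slopeSet {f ∈ M | x ≤ position M p f} η ⊆ slopeSet M η :=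
    Set.image_mono (Set.sep_subset _ _)
  rw [axisRank, ← Set.InjOn.ncard_image
    ((strictMonoOn_ncard_lt (hM.finite_slopeSet η)).injOn.mono hsub)]
  congr 3
  ext n
  constructor
  · rintro ⟨_, ⟨⟨f, hf, rfl⟩, hx⟩, rfl⟩
    exact ⟨_, ⟨f, ⟨hf, hx⟩, rfl⟩, rfl⟩
  · rintro ⟨_, ⟨f, ⟨hf, hx⟩, rfl⟩, rfl⟩
    exact ⟨_, ⟨⟨f, hf, rfl⟩, hx⟩, rfl⟩

/-- Adding constants gives infinitely many members, so finite sets can be padded to the size that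
condition (3) demands. -/
theorem IsTLS.infinite (hM : IsTLS D r M) (p : Γ.Point) {f : Γ.Point → ℝ} (hf : f ∈ M) :
    M.Infinite := by
  refine Set.infinite_of_injective_forall_mem (f := fun c : ℝ => fun q => f q + c) ?_
    fun c => hM.add_const_mem hf c
  intro c c' h
  simpa using congrFun h p

end

/-! ### Strongly recursive tropical linear series -/

theorem IsStronglyRecursive.isTLS {D : Γ.Divisor} {r : ℕ} {M : Set (Γ.Point → ℝ)}
    (hM : IsStronglyRecursive D r M) : IsTLS D r M := by
  rw [IsStronglyRecursive] at hM
  exact hM.1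

/-- Condition (3) lowers the rank by one: pad `T` to as many functions as the next rank requires,
pass to the subseries, and repeat until the rank is `k`. -/
theorem IsStronglyRecursive.exists_subseries {D : Γ.Divisor} (p : Γ.Point) {r : ℕ}
    {M : Set (Γ.Point → ℝ)} (hM : IsStronglyRecursive D r M) {k : ℕ} (hk : k ≤ r)
    {T : Finset (Γ.Point → ℝ)} (hT : (T : Set (Γ.Point → ℝ)) ⊆ M) (hcard : T.card = k + 1) :
    ∃ M' ⊆ M, (T : Set (Γ.Point → ℝ)) ⊆ M' ∧ IsStronglyRecursive D k M' := by
  induction r generalizing M with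
  | zero =>
    obtain rfl : k = 0 := by omega
    exact ⟨M, subset_rfl, hT, hM⟩
  | succ r ih =>
    rcases hk.eq_or_lt with rfl | hlt
    · exact ⟨M, subset_rfl, hT, hM⟩
    · obtain ⟨f, hf⟩ := Finset.card_pos.1 (by rw [hcard]; exact k.succ_pos)
      obtain ⟨T', hTT', hT', hc⟩ :=
        (hM.isTLS.infinite p (hT hf)).exists_superset_ncard_eq hT T.finite_toSet
          (k := r + 1) (by rw [Set.ncard_coe_finset]; omega)
      have hfin : T'.Finite := Set.finite_of_ncard_pos (by omega)
      rw [IsStronglyRecursive] at hM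
      obtain ⟨M₁, hM₁, hT₁, hr⟩ := hM.2.1 (by omega) hfin.toFinset (by simpa using hT')
        (by rw [← Set.ncard_eq_toFinset_card _ hfin, hc])
      rw [hfin.coe_toFinset] at hT₁
      obtain ⟨M', h1, h2, h3⟩ := ih hr (by omega) (hTT'.trans hT₁)
      exact ⟨M', h1.trans hM₁, h2, h3⟩

/-- One inequality suffices, as `η` and `θ` can be exchanged. A subseries spanned around
representatives of the slopes along `η` has equally many slopes along `θ`. -/
theorem IsStronglyRecursive.ncard_slopeSet_le {D : Γ.Divisor} {r : ℕ} {M : Set (Γ.Point → ℝ)}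
    (hM : IsStronglyRecursive D r M) {p : Γ.Point} (x : Γ.Tangent p → ℕ) (η θ : Γ.Tangent p) :
    (slopeSet {f ∈ M | x ≤ position M p f} η).ncard ≤
      (slopeSet {f ∈ M | x ≤ position M p f} θ).ncard := by
  classical
  set F := {f ∈ M | x ≤ position M p f} with hF
  have hFM : F ⊆ M := Set.sep_subset _ _
  have hfin (ζ : Γ.Tangent p) : (slopeSet F ζ).Finite :=
    (hM.isTLS.finite_slopeSet ζ).subset (Set.image_mono hFM)
  obtain ⟨T, hTF, hTW, hinj⟩ :=
    exists_finset_of_subset_image (F := F) (u := fun f => slope f η) (W := (hfin η).toFinset)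
      (by simp [slopeSet])
  rw [Set.ncard_eq_toFinset_card _ (hfin η), ← hTW]
  obtain h0 | ⟨k, hk⟩ : T.card = 0 ∨ ∃ k, T.card = k + 1 := by cases T.card <;> simp
  · simp [h0]
  have hkr := hM.isTLS.card_le_of_injOn (hTF.trans hFM) hinj
  obtain ⟨M', hM'M, hTM', hM'⟩ := hM.exists_subseries p (by omega) (hTF.trans hFM) hk
  -- Each coordinate of `h` is bounded below by that of some `f ∈ T`, depending on `ζ`; this is
  -- enough for the lower bound `x`.
  have hM'F : M' ⊆ F := by
    intro h hh
    by_cases hhT : h ∈ T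
    · exact hTF hhT
    refine ⟨hM'M hh, fun ζ => ?_⟩
    have hdep := hM'.isTLS.dependent (insert h T) (by
      rw [Finset.coe_insert]
      exact Set.insert_subset hh hTM') (by rw [Finset.card_insert_of_notMem hhT, hk])
    obtain ⟨f, hf, hle⟩ := exists_slope_le_of_dependent_insert
      (fun f hf => hM.isTLS.isPL (hFM (hTF hf))) (hM'.isTLS.isPL hh) hinj hdep ζ
    exact ((hTF hf).2 ζ).trans
      ((hM.isTLS.position_le_position_iff (hFM (hTF hf)) (hM'M hh) ζ).2 hle)
  rw [hk, ← hM'.isTLS.ncard_slopeSet θ]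
  exact Set.ncard_le_ncard (Set.image_mono hM'F) (hfin θ)

/-- For every `x`, the principal subarray of a local array has equal ranks along all axes. -/
theorem IsStronglyRecursive.hasRank_principal {D : Γ.Divisor} {r : ℕ} {M : Set (Γ.Point → ℝ)}
    (hM : IsStronglyRecursive D r M) {p : Γ.Point} (x : Γ.Tangent p → ℕ) (η : Γ.Tangent p) :
    HasRank (principal (localArray M p) x)
      ((slopeSet {f ∈ M | x ≤ position M p f} η).ncard - 1) := by
  intro θ
  rw [hM.isTLS.axisRank_principal,
    (hM.ncard_slopeSet_le x η θ).antisymm (hM.ncard_slopeSet_le x θ η)]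

/-! ### Limits of functions with spread-out zeros -/

/-- If the coefficients of a minimum are close to those of `f`, then the functions attaining it near
`p` attain `f` at `p`. -/
theorem IsMinOf.eventually_active {G : Finset (Γ.Point → ℝ)} {b : (Γ.Point → ℝ) → ℝ}
    {f : Γ.Point → ℝ} (hf : IsMinOf G b f) {p : Γ.Point} {η : Γ.Tangent p} {ε : ℝ} (hε : 0 < ε)
    (hlin : ∀ g ∈ G, ∀ s ∈ Set.Ico 0 ε, g (η.ray s) = g p + slope g η * s) :
    ∀ᶠ x : ((Γ.Point → ℝ) → ℝ) × ℝ in 𝓝 b ×ˢ 𝓝 0, 0 ≤ x.2 → ∀ g ∈ G, ∀ h, IsMinOf G x.1 h →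
      h (η.ray x.2) = g (η.ray x.2) + x.1 g → f p = g p + b g := by
  rw [← nhds_prod_eq]
  obtain ⟨j, hj, hfj⟩ := (hf p).2
  -- A term not attaining `f` at `p` lies strictly above `j` there, a condition that persists under
  -- small changes of the coefficients and of the parameter.
  have key : ∀ g ∈ G, ∀ᶠ x : ((Γ.Point → ℝ) → ℝ) × ℝ in 𝓝 (b, 0), f p ≠ g p + b g →
      j p + slope j η * x.2 + x.1 j < g p + slope g η * x.2 + x.1 g := by
    intro g hg
    by_cases h : f p = g p + b g
    · exact .of_forall fun _ h' => absurd h h'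
    · have hlt : j p + b j < g p + b g := hfj ▸ lt_of_le_of_ne ((hf p).1 g hg) h
      refine Filter.Eventually.mono (ContinuousAt.eventually_lt (by fun_prop) (by fun_prop) ?_)
        fun _ hx _ => hx
      simpa using hlt
  have hsnd : ∀ᶠ x : ((Γ.Point → ℝ) → ℝ) × ℝ in 𝓝 (b, 0), x.2 < ε :=
    continuousAt_snd.eventually_lt continuousAt_const hε
  filter_upwards [(Filter.eventually_all_finset G).2 key, hsnd] with x hx hxε h0 g hg h hh he
  by_contra hne
  have h1 := hx g hg hne
  rw [← hlin g hg _ ⟨h0, hxε⟩, ← hlin j hj _ ⟨h0, hxε⟩] at h1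
  linarith [(hh (η.ray x.2)).1 j hj]

/-- For every effective divisor `A` of degree `r` there is a function `f` in the series which
vanishes on `A`, such that at every point `p` the functions of the series whose slopes at `p` are
all at least those of `f` have at least `A p + 1` different slopes along some tangent vector. -/
theorem IsTLS.exists_generic [Finite E] (hΓ : ∀ v : V, ∃ e : E, Γ.src e = v ∨ Γ.tgt e = v)
    {D : Γ.Divisor} {r : ℕ} {M : Set (Γ.Point → ℝ)} (hM : IsTLS D r M) {A : Γ.Divisor}
    (hA : 0 ≤ A) (hdeg : deg A = r) :
    ∃ f ∈ M, DivAddGE D f A ∧ ∀ p ∈ A.support, ∃ (η : Γ.Tangent p) (W : Finset ℤ),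
      W.card = (A p).toNat + 1 ∧
      ∀ m ∈ W, ∃ g ∈ M, slope g η = m ∧ ∀ θ : Γ.Tangent p, slope f θ ≤ slope g θ := by
  classical
  obtain ⟨G, hMG, hGM⟩ := hM.exists_generators
  have hGPL : ∀ g ∈ G, IsPL g := fun g hg => hM.isPL (hGM g hg)
  obtain ⟨C, hC⟩ := exists_bounded_isMinOf fun g hg => (hGPL g hg).exists_bound hΓ
  let η (p : Γ.Point) : Γ.Tangent p := Classical.choice (nonempty_tangent hΓ p)
  choose ε hε hlin hmem hD using fun p => (η p).exists_segment D hGPL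
  choose! S hSsub hScard using fun (t : ℝ) (ht : 0 < t) (p : Γ.Point) =>
    (Set.Ioo_infinite (lt_min ht (hε p))).exists_subset_card_eq (A p).toNat
  have hApos : ∀ p, ((A p).toNat : ℤ) = A p := fun p => Int.toNat_of_nonneg (hA p)
  -- Points from different `p` are allowed to coincide: only the total degree, and a coefficient at
  -- least `1` at each point, matter.
  let B (t : ℝ) : Γ.Divisor :=
    ∑ i ∈ A.support.sigma (S t), Finsupp.single ((η i.1).ray i.2) (1 : ℤ)
  have hBdeg (t : ℝ) (ht : 0 < t) : deg (B t) = r := by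
    rw [deg_sum_single, Finset.card_sigma, ← hdeg, deg, Finsupp.sum]
    push_cast
    exact Finset.sum_congr rfl fun p _ => by rw [hScard t ht p, hApos p]
  have hh (t : ℝ) (ht : 0 < t) : ∃ (h : Γ.Point → ℝ) (a : (Γ.Point → ℝ) → ℝ), h ∈ M ∧
      DivAddGE D h (B t) ∧ a ∈ Set.univ.pi (fun _ => Set.Icc 0 C) ∧ IsMinOf G a h := by
    obtain ⟨h, hhM, hhB⟩ := hM.rank (B t) (sum_single_nonneg _ _) (hBdeg t ht)
    obtain ⟨c, a, ha, hmin⟩ := hC h (hMG ▸ hhM)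
    refine ⟨_, a, hM.add_const_mem hhM c, fun p => ?_, fun g _ => ha g, hmin⟩
    rw [ord_add_const]
    exact hhB p
  choose! h a hhM hhB haC hmin using hh
  -- The coefficients are indexed by all functions, so compactness is Tychonoff's theorem, and a
  -- cluster point takes the place of a convergent subsequence.
  have hK : IsCompact (Set.univ.pi (fun _ : Γ.Point → ℝ => Set.Icc 0 C)) :=
    isCompact_univ_pi fun _ => isCompact_Icc
  have haK : ∀ᶠ t in 𝓝[>] (0 : ℝ), a t ∈ Set.univ.pi (fun _ : Γ.Point → ℝ => Set.Icc 0 C) :=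
    Filter.eventually_of_mem self_mem_nhdsWithin haC
  obtain ⟨b, -, hb⟩ := hK.exists_mapClusterPt_of_frequently haK.frequently
  have hGne : G.Nonempty := by
    obtain ⟨T, ⟨g, hg⟩, -, hTG, -⟩ := hMG ▸ hhM 1 one_pos
    exact ⟨g, hTG hg⟩
  obtain ⟨f, hf⟩ : ∃ f, IsMinOf G b f := ⟨_, isMinOf_inf' hGne b⟩
  have hfM : f ∈ M := hMG ▸ hf.mem_tropicalSpan hGne
  have hfPL := hM.isPL hfM
  have hev := (Filter.eventually_all_finset A.support).2 fun p _ =>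
    hf.eventually_active (hε p) (hlin p)
  obtain ⟨P, hP, Q, hQ, hPQ⟩ := Filter.eventually_prod_iff.1 hev
  obtain ⟨δ, hδ, hQδ⟩ := Metric.eventually_nhds_iff.1 hQ
  obtain ⟨t, hPt, ht⟩ := ((hb.frequently hP).and_eventually (Ioo_mem_nhdsGT hδ)).exists
  have ht0 := ht.1
  have hact (p : Γ.Point) (hp : p ∈ A.support) (g : Γ.Point → ℝ) (hg : g ∈ G) (s : ℝ)
      (hs : s ∈ insert 0 (S t p)) (he : h t ((η p).ray s) = g ((η p).ray s) + a t g) :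
      f p = g p + b g := by
    have hst : 0 ≤ s ∧ s < t := by
      rcases Finset.mem_insert.1 hs with rfl | hs
      · exact ⟨le_rfl, ht0⟩
      · have := hSsub t ht0 p hs
        exact ⟨this.1.le, this.2.trans_le (min_le_left _ _)⟩
    refine hPQ hPt (hQδ ?_) p hp hst.1 g hg (h t) (hmin t ht0) he
    rw [dist_zero_right, Real.norm_of_nonneg hst.1]
    exact hst.2.trans ht.2
  have hle (p : Γ.Point) (g : Γ.Point → ℝ) (hg : g ∈ G) (he : f p = g p + b g)
      (θ : Γ.Tangent p) : slope f θ ≤ slope g θ :=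
    slope_le_slope_of_le hfPL (hGPL g hg) θ (fun q => (hf q).1 g hg) he
  have hW (p : Γ.Point) (hp : p ∈ A.support) : ∃ W : Finset ℤ, W.card = (A p).toNat + 1 ∧
      ∀ m ∈ W, m ≤ slope (h t) (η p) ∧ ∃ g ∈ G, slope g (η p) = m ∧ f p = g p + b g := by
    obtain ⟨W, hWcard, hW⟩ := (hmin t ht0).exists_card_slopes (hM.isPL (hhM t ht0)) hGPL (hlin p)
      (hmem p) (S := S t p) fun s hs => by
        have hs' := hSsub t ht0 p hs
        have hs'' : s ∈ Set.Ioo 0 (ε p) := ⟨hs'.1, hs'.2.trans_le (min_le_right _ _)⟩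
        refine ⟨hs'', fun h0 => ?_⟩
        have h1 := hhB t ht0 ((η p).ray s)
        have h2 := one_le_sum_single (s := A.support.sigma (S t)) (fun i => (η i.1).ray i.2)
          (i := ⟨p, s⟩) (Finset.mem_sigma.2 ⟨hp, hs⟩)
        rw [h0, hD p s hs''] at h1
        exact absurd (h2.trans h1) (by norm_num)
    refine ⟨W, by rw [hWcard, hScard t ht0 p], fun m hm => ?_⟩
    obtain ⟨h1, g, hg, h2, s, hs, h3⟩ := hW m hm
    exact ⟨h1, g, hg, h2, hact p hp g hg s hs h3⟩
  refine ⟨f, hfM, fun p => ?_, fun p hp => ?_⟩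
  · by_cases hp : p ∈ A.support
    · obtain ⟨W, hWcard, hW⟩ := hW p hp
      have hslope (θ : Γ.Tangent p) : slope f θ ≤ slope (h t) θ := by
        obtain ⟨g, hg, h1, h2⟩ := (hmin t ht0).exists_slope_eq (hM.isPL (hhM t ht0)) hGPL θ
        exact h2 ▸ hle p g hg (hact p hp g hg 0 (Finset.mem_insert_self _ _) (by simpa using h1)) θ
      -- The `A p + 1` integers of `W` all lie between the two slopes.
      have hgap : A p ≤ slope (h t) (η p) - slope f (η p) := by
        have hsub : W ⊆ Finset.Icc (slope f (η p)) (slope (h t) (η p)) := fun m hm => by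
          obtain ⟨h1, g, hg, rfl, h2⟩ := hW m hm
          exact Finset.mem_Icc.2 ⟨hle p g hg h2 _, h1⟩
        have hcard := Finset.card_le_card hsub
        rw [Int.card_Icc, hWcard] at hcard
        have := hApos p
        omega
      have h1 := hhB t ht0 p
      have h2 : 0 ≤ B t p := sum_single_nonneg _ (fun i : Σ _ : Γ.Point, ℝ => (η i.1).ray i.2) p
      have := Fintype.ofFinite (Γ.Tangent p)
      -- No slope of `h t` at `p` is below that of `f`, and along `η p` the excess is at least `A
      -- p`. Hence `ord f p ≥ ord (h t) p + A p`.
      have h3 := Finset.single_le_sum (f := fun θ => slope (h t) θ - slope f θ)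
        (fun θ _ => sub_nonneg.2 (hslope θ)) (Finset.mem_univ (η p))
      rw [Finset.sum_sub_distrib] at h3
      simp only [ord, finsum_eq_sum_of_fintype] at h1 ⊢
      linarith
    · rw [Finsupp.notMem_support_iff.1 hp]
      exact (hM.subset hfM).2 p
  · obtain ⟨W, hWcard, hW⟩ := hW p hp
    refine ⟨η p, W, hWcard, fun m hm => ?_⟩
    obtain ⟨-, g, hg, h1, h2⟩ := hW m hm
    exact ⟨g, hGM g hg, h1, hle p g hg h2⟩

/-- The local rank of `f` at `p` is at least `n` if there are functions with `n + 1` different slopes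
along some tangent vector at `p`, whose slopes at `p` are all at least those of `f`. -/
theorem IsStronglyRecursive.le_localRank {D : Γ.Divisor} {r : ℕ} {M : Set (Γ.Point → ℝ)}
    (hM : IsStronglyRecursive D r M) {f : Γ.Point → ℝ} (hf : f ∈ M) {p : Γ.Point}
    {η : Γ.Tangent p} {W : Finset ℤ}
    (hW : ∀ m ∈ W, ∃ g ∈ M, slope g η = m ∧ ∀ θ : Γ.Tangent p, slope f θ ≤ slope g θ) :
    (W.card : ℤ) - 1 ≤ localRank M p f := by
  have : Nonempty (Γ.Tangent p) := ⟨η⟩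
  rw [localRank, rankArray_eq (hM.hasRank_principal _ η), ← Set.ncard_coe_finset]
  refine sub_le_sub_right (Nat.cast_le.2 (Set.ncard_le_ncard (fun m hm => ?_)
    ((hM.isTLS.finite_slopeSet η).subset (Set.image_mono (Set.sep_subset _ _))))) _
  obtain ⟨g, hg, rfl, hle⟩ := hW m hm
  exact ⟨g, ⟨hg, fun θ => (hM.isTLS.position_le_position_iff hf hg θ).2 (hle θ)⟩, rfl⟩

end MetricGraph

theorem mainTheorem3 {V E : Type*} [Finite V] [Finite E] (Γ : MetricGraph V E)
    (hΓ : ∀ v : V, ∃ e : E, Γ.src e = v ∨ Γ.tgt e = v)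
    (D : Γ.Divisor) (r : ℕ) (M : Set (Γ.Point → ℝ))
    (hM : MetricGraph.IsStronglyRecursive D r M) :
    (∀ (p : Γ.Point) (η : Γ.Tangent p), (MetricGraph.slopeSet M η).ncard = r + 1) ∧
    (∀ p : Γ.Point, MetricGraph.TotallyRankable (MetricGraph.localArray M p)) ∧
    ∀ A : Γ.Divisor, 0 ≤ A → MetricGraph.deg A = r →
      ∃ f ∈ M, MetricGraph.DivAddGE D f A ∧ MetricGraph.LocalRankProperty M f A := by
  refine ⟨fun p η => hM.isTLS.ncard_slopeSet η, fun p x => ?_, fun A hA hdeg => ?_⟩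
  · obtain ⟨η⟩ := MetricGraph.nonempty_tangent hΓ p
    exact ⟨_, hM.hasRank_principal x η⟩
  · obtain ⟨f, hf, hfA, hW⟩ := hM.isTLS.exists_generic hΓ hA hdeg
    refine ⟨f, hf, hfA, fun p => ?_⟩
    by_cases hp : p ∈ A.support
    · obtain ⟨η, W, hcard, hW⟩ := hW p hp
      have h := hM.le_localRank hf hW
      have := Int.toNat_of_nonneg (hA p)
      rw [hcard] at h
      push_cast at h
      omega
    · obtain ⟨η⟩ := MetricGraph.nonempty_tangent hΓ p
      -- Off the support only local rank at least `0` is needed, for which `f` is its own witness.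
      have h := hM.le_localRank hf (η := η) (W := {MetricGraph.slope f η}) fun m hm =>
        ⟨f, hf, (Finset.mem_singleton.1 hm).symm, fun _ => le_rfl⟩
      rw [Finsupp.notMem_support_iff.1 hp]
      simpa using h
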